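/- Consider an LTI plant with a linear dynamic controller, $$x_{t+1}=Ax_t+Bu_t+w_t,\quad y_t=Cx_t+v_t,\qquad \mathcal X_t=A_c\mathcal X_{t-1}+B_cy^c_t,\quad u_t=C_c\mathcal X_t,$$ with $x_t\in\mathbb R^n$, $u_t\in\mathbb R^m$, $y_t\in\mathbb R^p$, $\mathcal X_t\in\mathbb R^r$, which starts operating at a time $-T\le 0$ from a (possibly random) plant state $x_{-T}$ and a deterministic controller state $\mathcal X_{-T}$; the controller state is updated by the second pair of equations for $t>-T$. The noises $(w_t)$ and $(v_t)$ are i.i.d. $\mathcal N(0,R_w)$ and i.i.d. $\mathcal N(0,R_v)$ with $R_w,R_v\succ0$, and $x_{-T}$, $(w_t)$, $(v_t)$ are independent. Without attack, $y^c_t=y_t$ for all $t$. Under a sensor attack $a_0,a_1,\dots$ (a random sequence in $\mathbb R^p$, $a_t$ being a measurable function of $x_{-T}$ and of the noises $w_k$, $k<t$, and $v_k$, $k\le t$), the system has the same initial states and noises, but the controller receives $y^{c,a}_t=Cx^a_t+v_t+a_t$ for $t\ge0$; superscripts $a$ denote the signals of the attacked system. A detector at time $t$ is a measurable map from the received measurements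 at times $-T,\dots,t$ to $\{0,1\}$. For $\epsilon>0$, the attack is $\epsilon$-stealthy if at no time $t\ge0$ there is a detector $D$ for which the probability that $D=1$ on the measurements received under attack exceeds the probability that $D=1$ on the measurements received without attack by more than $\epsilon$. It is $(\epsilon,\alpha)$-successful if it is $\epsilon$-stealthy and there is a time $t'\ge0$ with $\|x^a_{t'}-x_{t'}\|\ge\alpha$ almost surely. The system is $(\epsilon,\alpha)$-attackable if an $(\epsilon,\alpha)$-successful attack exists. Suppose that $A$ is unstable, i.e. has an eigenvalue $\lambda\in\mathbb C$ with $|\lambda|>1$, and that the closed-loop system is asymptotically stable, i.e. the origin is an asymptotically stable equilibrium of the noise-free and attack-free closed-loop dynamics of $(x_t,\mathcal X_t)$. Then: 1. The system is $(\epsilon,\alpha)$-attackable for every $\epsilon>0$ and every $\alpha\in\mathbb R$, hence for arbitrarily small $\epsilon$ and arbitrarily large $\alpha$. 2. The attack needs only $A$ and $C$. For every eigenvector $q\in\mathbb C^n$ of $A$ to an eigenvalue $\lambda$ with $|\lambda|>1$ such that $\operatorname{Re}q\ne0$ (if $q$ is real, $\operatorname{Re}q=q$), and for every $\epsilon>0$,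 there is $c_0>0$ such that for every real $c$ with $0<|c|\le c_0$ the deterministic attack $$s_0=c\operatorname{Re}q,\qquad s_{t+1}=As_t,\qquad a_t=-Cs_t$$ is $(\epsilon,\alpha)$-successful for every $\alpha\in\mathbb R$. -/

import Mathlib

open MeasureTheory ProbabilityTheory Filter Topology

noncomputable section

namespace SensorAttack

/-- `ℝᵈ` with the Euclidean norm. -/
abbrev Vec (d : ℕ) : Type := EuclideanSpace ℝ (Fin d)

/-- The matrix-vector product, on Euclidean spaces. -/
abbrev act {a b : ℕ} (M : Matrix (Fin a) (Fin b) ℝ) (x : Vec b) : Vec a :=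
  Matrix.toEuclideanLin M x

/-- The matrices of an LTI plant `x⁺ = A x + B u + w`, `y = C x + v` with a linear dynamic
controller `X = Ac X⁻ + Bc yᶜ`, `u = Cc X`; `n`, `m`, `p`, `r` are the dimensions of the
plant state, the input, the output and the controller state. -/
structure LTISystem (n m p r : ℕ) where
  A : Matrix (Fin n) (Fin n) ℝ
  B : Matrix (Fin n) (Fin m) ℝ
  C : Matrix (Fin p) (Fin n) ℝ
  Ac : Matrix (Fin r) (Fin r) ℝ
  Bc : Matrix (Fin r) (Fin p) ℝ
  Cc : Matrix (Fin m) (Fin r) ℝ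

/-- `lam` is an eigenvalue of the real matrix `A` outside the closed unit disc, with complex
eigenvector `q`. -/
def IsUnstableEigenpair {n : ℕ} (A : Matrix (Fin n) (Fin n) ℝ) (lam : ℂ) (q : Fin n → ℂ) :
    Prop :=
  1 < ‖lam‖ ∧
    Module.End.HasEigenvector (Matrix.toLin' (A.map (algebraMap ℝ ℂ))) lam q

/-- A real matrix is unstable (in discrete time) if it has an eigenvalue outside the closed
unit disc. -/
def IsUnstable {n : ℕ} (A : Matrix (Fin n) (Fin n) ℝ) : Prop :=
  ∃ (lam : ℂ) (q : Fin n → ℂ), IsUnstableEigenpair A lam q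

/-- The coordinatewise real part of a complex vector. -/
def reVec {n : ℕ} (q : Fin n → ℂ) : Vec n := WithLp.toLp 2 fun i => (q i).re

/-- The origin is an asymptotically stable equilibrium of `X⁺ = F X`: it is Lyapunov stable
and attracts all trajectories that start near it. -/
def IsAsymptoticallyStable {E : Type*} [NormedAddCommGroup E] (F : E → E) : Prop :=
  (∀ ε : ℝ, 0 < ε → ∃ δ : ℝ, 0 < δ ∧ ∀ X : E, ‖X‖ < δ → ∀ t : ℕ, ‖F^[t] X‖ < ε) ∧
    ∃ δ : ℝ, 0 < δ ∧ ∀ X : E, ‖X‖ < δ → Tendsto (fun t : ℕ => F^[t] X) atTop (𝓝 0)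

namespace LTISystem

variable {n m p r : ℕ} (S : LTISystem n m p r)

/-- One step of the closed loop, from the plant and controller states `(x, X)` at a time `t` to
those at time `t + 1`; `w` is the process noise at time `t`, `v` the measurement noise at time
`t + 1`, and `a` the value added to the measurement at time `t + 1`. -/
def step (w : Vec n) (v a : Vec p) (z : Vec n × Vec r) : Vec n × Vec r :=
  let x' : Vec n := act S.A z.1 + act S.B (act S.Cc z.2) + w
  let y' : Vec p := act S.C x' + v + a
  (x', act S.Ac z.2 + act S.Bc y')

/-- The closed-loop system is asymptotically stable. -/
def ClosedLoopStable : Prop :=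
  IsAsymptoticallyStable (S.step 0 0 0)

/-- Closed-loop trajectory, `k` steps after the system starts operating from plant state `x₀`
and controller state `X₀`; `inj k` is the value added to the `k`-th measurement. -/
def traj (x₀ : Vec n) (X₀ : Vec r) (w : ℕ → Vec n) (v inj : ℕ → Vec p) :
    ℕ → Vec n × Vec r
  | 0 => (x₀, X₀)
  | k + 1 => S.step (w k) (v (k + 1)) (inj (k + 1)) (traj x₀ X₀ w v inj k)

end LTISystem

/-- The random data of the system: the initial plant state, and the process and measurement
noises. Index `k` is the number of steps since the system started operating. -/
structure Disturbance (Ω : Type*) (n p : ℕ) where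
  init : Ω → Vec n
  w : ℕ → Ω → Vec n
  v : ℕ → Ω → Vec p

/-- The process noise is i.i.d. `N(0, Rw)`, the measurement noise is i.i.d. `N(0, Rv)`, and the
initial state, the process noise and the measurement noise are independent. The law of the
initial state is arbitrary (in particular, it may be deterministic). -/
structure Disturbance.IsGaussianNoise {Ω : Type*} [MeasurableSpace Ω] {n p : ℕ}
    (d : Disturbance Ω n p) (μ : Measure Ω)
    (Rw : Matrix (Fin n) (Fin n) ℝ) (Rv : Matrix (Fin p) (Fin p) ℝ) : Prop where
  measurable_init : Measurable d.init
  measurable_w : ∀ k, Measurable (d.w k)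
  measurable_v : ∀ k, Measurable (d.v k)
  law_w : ∀ k, HasLaw (d.w k) (multivariateGaussian 0 Rw) μ
  law_v : ∀ k, HasLaw (d.v k) (multivariateGaussian 0 Rv) μ
  iIndepFun_w : iIndepFun d.w μ
  iIndepFun_v : iIndepFun d.v μ
  indepFun_w_v : IndepFun (fun ω k => d.w k ω) (fun ω k => d.v k ω) μ
  indepFun_init : IndepFun d.init (fun ω => (fun k => d.w k ω, fun k => d.v k ω)) μ

/-- What is added to the `k`-th measurement when the attack sequence `a₀, a₁, …` starts `T` steps
after the system started operating. -/
def injection {p : ℕ} (T : ℕ) (a : ℕ → Vec p) (k : ℕ) : Vec p :=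
  if T ≤ k then a (k - T) else 0

section Attack

variable {Ω : Type*} {n m p r : ℕ}

/-- The plant state at time `t ≥ 0` when the attack `a` is injected from time `0` on. The system
starts at time `-T`, with controller state `X₀`. -/
def plantState (S : LTISystem n m p r) (T : ℕ) (X₀ : Vec r) (d : Disturbance Ω n p)
    (a : ℕ → Ω → Vec p) (t : ℕ) (ω : Ω) : Vec n :=
  (S.traj (d.init ω) X₀ (fun k => d.w k ω) (fun k => d.v k ω)
    (injection T fun k => a k ω) (T + t)).1

/-- The measurements received by the controller and by the intrusion detector at the times
`-T, …, t` when the attack `a` is injected from time `0` on. -/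
def received (S : LTISystem n m p r) (T : ℕ) (X₀ : Vec r) (d : Disturbance Ω n p)
    (a : ℕ → Ω → Vec p) (t : ℕ) (ω : Ω) : Fin (T + t + 1) → Vec p := fun i =>
  act S.C (S.traj (d.init ω) X₀ (fun k => d.w k ω) (fun k => d.v k ω)
    (injection T fun k => a k ω) i).1 + d.v i ω + injection T (fun k => a k ω) i

/-- An attack is a process whose value at each time `t` is a measurable function of the initial
state and of the noises that have entered the state and the measurements by then. (The
system, its state, its inputs and its measurements up to time `t` are functions of these.) -/
def IsCausalAttack (T : ℕ) (d : Disturbance Ω n p) (a : ℕ → Ω → Vec p) : Prop :=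
  ∀ t : ℕ, ∃ g : Vec n × (Fin (T + t) → Vec n) × (Fin (T + t + 1) → Vec p) → Vec p,
    Measurable g ∧
      ∀ ω, a t ω = g (d.init ω, (fun i => d.w i ω), (fun i => d.v i ω))

variable [MeasurableSpace Ω]

/-- Probability that the detector `D`, which uses all measurements up to time `t`, raises an alarm
when the attack is `a`. For an actual attack this is the probability of true detection, and for
`a = 0` it is the probability of false alarm. -/
def alarmProb (S : LTISystem n m p r) (T : ℕ) (X₀ : Vec r) (d : Disturbance Ω n p)
    (μ : Measure Ω) (a : ℕ → Ω → Vec p) (t : ℕ) (D : (Fin (T + t + 1) → Vec p) → Bool) : ℝ :=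
  μ.real {ω | D (received S T X₀ d a t ω) = true}

/-- `ε`-stealthiness: at no time does any detector have a probability of true detection that
exceeds its probability of false alarm by more than `ε`. -/
def IsStealthy (S : LTISystem n m p r) (T : ℕ) (X₀ : Vec r) (d : Disturbance Ω n p)
    (μ : Measure Ω) (ε : ℝ) (a : ℕ → Ω → Vec p) : Prop :=
  ¬ ∃ (t : ℕ) (D : (Fin (T + t + 1) → Vec p) → Bool), Measurable D ∧
    alarmProb S T X₀ d μ a t D - alarmProb S T X₀ d μ 0 t D > ε

/-- `(ε, α)`-successful attacks: `ε`-stealthy, and at some time `t ≥ 0` the states with and without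
the attack, under the same noise, are at least `α` apart. -/
def IsSuccessful (S : LTISystem n m p r) (T : ℕ) (X₀ : Vec r) (d : Disturbance Ω n p)
    (μ : Measure Ω) (ε α : ℝ) (a : ℕ → Ω → Vec p) : Prop :=
  (∃ t : ℕ, ∀ᵐ ω ∂μ, α ≤ ‖plantState S T X₀ d a t ω - plantState S T X₀ d 0 t ω‖) ∧
    IsStealthy S T X₀ d μ ε a

/-- `(ε, α)`-attackable systems: an `(ε, α)`-successful attack exists. -/
def IsAttackable (S : LTISystem n m p r) (T : ℕ) (X₀ : Vec r) (d : Disturbance Ω n p)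
    (μ : Measure Ω) (ε α : ℝ) : Prop :=
  ∃ a : ℕ → Ω → Vec p, IsCausalAttack T d a ∧ IsSuccessful S T X₀ d μ ε α a

end Attack

/-- The sequence `s_{t+1} = A s_t` with given `s_0`. -/
def deviation {n : ℕ} (A : Matrix (Fin n) (Fin n) ℝ) (s₀ : Vec n) : ℕ → Vec n
  | 0 => s₀
  | t + 1 => act A (deviation A s₀ t)

/-- The attack sequence `a_t = -C s_t` with `s_{t+1} = A s_t`; it uses only `A`, `C` and `s_0`. -/
def linearAttack {n p : ℕ} (A : Matrix (Fin n) (Fin n) ℝ) (C : Matrix (Fin p) (Fin n) ℝ)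
    (s₀ : Vec n) (t : ℕ) : Vec p :=
  -act C (deviation A s₀ t)

end SensorAttack

end

open SensorAttack

/-! Subtracting `s_t` from the attacked plant state from just after time 0 on hides the attack. The
corrected state still follows the plant equation, and the received value `C x^a_t + v_t - C s_t` is
its honest measurement. Only the moment of onset leaves a trace: the attacked system produces
exactly the measurements of an unattacked one whose noises at time 0 are shifted, `w_0` by `-A s_0`
and `v_0` by `-C s_0` (`measurements_linearAttack`). The prior state need not be shifted, so its law
can be arbitrary.

Stealthiness is thus a statement about two fixed shifts, uniform in time and in the detector.
Nondegenerate Gaussian laws vary continuously in total variation under translation, so a small `s_0`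
suffices (`eventually_isStealthy`).

The attacked and the unattacked state differ by `s_t` plus an orbit of the noise-free closed loop
(`traj_linearAttack`). That orbit is bounded by stability, whereas `s_t = c Re(λ^t q)` is unbounded
(`exists_lt_norm_deviation`). -/

namespace SensorAttack

open scoped ENNReal

/-! ### One-sided total variation bounds -/

section Excess

variable {E F : Type*} [MeasurableSpace E] [MeasurableSpace F]

/-- The measure `ρ` exceeds the measure `σ` by at most `ε` on every measurable set. -/
def ExcessLE (ρ σ : Measure E) (ε : ℝ≥0∞) : Prop :=
  ∀ s, MeasurableSet s → ρ s ≤ σ s + ε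

lemma ExcessLE.trans {ρ σ τ : Measure E} {ε δ : ℝ≥0∞} (h₁ : ExcessLE ρ σ ε)
    (h₂ : ExcessLE σ τ δ) : ExcessLE ρ τ (δ + ε) := fun s hs =>
  (h₁ s hs).trans (by rw [← add_assoc]; gcongr; exact h₂ s hs)

lemma ExcessLE.map {ρ σ : Measure E} {ε : ℝ≥0∞} (h : ExcessLE ρ σ ε) {f : E → F}
    (hf : Measurable f) : ExcessLE (ρ.map f) (σ.map f) ε := fun s hs => by
  rw [Measure.map_apply hf hs, Measure.map_apply hf hs]
  exact h _ (hf hs)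

lemma ExcessLE.prod_const {ρ σ : Measure E} [SFinite ρ] [SFinite σ] {ε : ℝ≥0∞}
    (h : ExcessLE ρ σ ε) (κ : Measure F) [IsProbabilityMeasure κ] :
    ExcessLE (ρ.prod κ) (σ.prod κ) ε := fun s hs => by
  rw [Measure.prod_apply_symm hs, Measure.prod_apply_symm hs]
  calc ∫⁻ y, ρ ((fun x => (x, y)) ⁻¹' s) ∂κ
      ≤ ∫⁻ y, (σ ((fun x => (x, y)) ⁻¹' s) + ε) ∂κ :=
        lintegral_mono fun y => h _ (measurable_prodMk_right hs)
    _ = _ := by rw [lintegral_add_right _ measurable_const]; simp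

lemma ExcessLE.const_prod {ρ σ : Measure E} [SFinite ρ] [SFinite σ] {ε : ℝ≥0∞}
    (h : ExcessLE ρ σ ε) (κ : Measure F) [IsProbabilityMeasure κ] :
    ExcessLE (κ.prod ρ) (κ.prod σ) ε := by
  rw [← Measure.prod_swap (μ := ρ), ← Measure.prod_swap (μ := σ)]
  exact (h.prod_const κ).map measurable_swap

/-- The factors are exchanged one at a time, through the intermediate product of `σ` with `ρ'`, so
the errors add. -/
lemma ExcessLE.prod {ρ σ : Measure E} [IsProbabilityMeasure ρ] [IsProbabilityMeasure σ]
    {ρ' σ' : Measure F} [IsProbabilityMeasure ρ'] [IsProbabilityMeasure σ']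
    {ε δ : ℝ≥0∞} (h : ExcessLE ρ σ ε) (h' : ExcessLE ρ' σ' δ) :
    ExcessLE (ρ.prod ρ') (σ.prod σ') (δ + ε) :=
  (h.prod_const ρ').trans (h'.const_prod σ)

end Excess

/-! ### Gaussian laws under small translations -/

/-- Small translations change the measure little, uniformly over all measurable sets. -/
def TranslationContinuous {E : Type*} [AddCommGroup E] [TopologicalSpace E] [MeasurableSpace E]
    (ν : Measure E) : Prop :=
  ∀ ε : ℝ≥0∞, ε ≠ 0 → ∀ᶠ h in 𝓝 (0 : E), ExcessLE (ν.map fun x => x + h) ν ε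

lemma TranslationContinuous.prod {E F : Type*} [NormedAddCommGroup E]
    [MeasurableSpace E] [BorelSpace E] [NormedAddCommGroup F] [MeasurableSpace F] [BorelSpace F]
    [SecondCountableTopology E] [SecondCountableTopology F]
    {ν : Measure E} [IsProbabilityMeasure ν] {κ : Measure F}
    [IsProbabilityMeasure κ] (hν : TranslationContinuous ν) (hκ : TranslationContinuous κ) :
    TranslationContinuous (ν.prod κ) := by
  intro ε hε
  have hε2 : ε / 2 ≠ 0 := by simpa using hε
  have h1 : Tendsto Prod.fst (𝓝 (0 : E × F)) (𝓝 0) := continuous_fst.tendsto 0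
  have h2 : Tendsto Prod.snd (𝓝 (0 : E × F)) (𝓝 0) := continuous_snd.tendsto 0
  filter_upwards [h1.eventually (hν _ hε2), h2.eventually (hκ _ hε2)] with h hh1 hh2
  have m1 : Measurable fun x : E => x + h.1 := by fun_prop
  have m2 : Measurable fun x : F => x + h.2 := by fun_prop
  have := Measure.isProbabilityMeasure_map (μ := ν) m1.aemeasurable
  have := Measure.isProbabilityMeasure_map (μ := κ) m2.aemeasurable
  have key := hh1.prod hh2
  rw [ENNReal.add_halves, Measure.map_prod_map _ _ m1 m2] at key
  exact key

section Translation

variable {E F : Type*} [NormedAddCommGroup E] [NormedSpace ℝ E] [MeasurableSpace E] [BorelSpace E]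
  [NormedAddCommGroup F] [NormedSpace ℝ F] [MeasurableSpace F] [BorelSpace F]

lemma TranslationContinuous.map {ν : Measure E} (hν : TranslationContinuous ν) (e : E ≃L[ℝ] F) :
    TranslationContinuous (ν.map e) := by
  intro ε hε
  have h0 : Tendsto e.symm (𝓝 0) (𝓝 0) := by
    simpa using (e.symm.continuous.tendsto 0)
  filter_upwards [h0.eventually (hν ε hε)] with h hh
  have he : Measurable e := e.continuous.measurable
  have := hh.map he
  rw [Measure.map_map he (by fun_prop)] at this
  rw [Measure.map_map (by fun_prop) he]
  convert this using 3 with x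
  ext x
  simp

/-- The excess is at most the `L¹` distance of the densities, which tends to 0 with the shift by
dominated convergence. -/
lemma translationContinuous_gaussianReal : TranslationContinuous (gaussianReal 0 1) := by
  have key : Tendsto (fun h : ℝ =>
      ∫⁻ x, ENNReal.ofReal |gaussianPDFReal h 1 x - gaussianPDFReal 0 1 x|)
      (𝓝 0) (𝓝 0) := by
    have hc : ∀ x : ℝ, Continuous fun h : ℝ => gaussianPDFReal h 1 x := fun x => by
      unfold gaussianPDFReal; fun_prop
    have := tendsto_lintegral_filter_of_dominated_convergence (μ := volume) (l := 𝓝 (0 : ℝ))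
      (F := fun h x => ENNReal.ofReal |gaussianPDFReal h 1 x - gaussianPDFReal 0 1 x|)
      (f := fun _ => 0)
      -- For `|h| ≤ 1`, `-(x - h)²/2 ≤ 1 - x²/4`, because `(x - 2h)² ≥ 0`. The factor 2 leaves room
      -- for both densities.
      (fun x => ENNReal.ofReal (2 * (Real.exp 1 * Real.exp (-(1 / 4) * x ^ 2)))) ?_ ?_ ?_ ?_
    · simpa using this
    · refine Eventually.of_forall fun h => ?_
      have := measurable_gaussianPDFReal h 1
      have := measurable_gaussianPDFReal 0 1
      fun_prop
    · have hb : ∀ h : ℝ, |h| ≤ 1 → ∀ x : ℝ,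
          gaussianPDFReal h 1 x ≤ Real.exp 1 * Real.exp (-(1 / 4) * x ^ 2) := by
        intro h hh x
        have h1 : (√(2 * Real.pi * (1 : NNReal)))⁻¹ ≤ 1 := by
          apply inv_le_one_of_one_le₀
          rw [Real.one_le_sqrt]
          have := Real.pi_gt_three
          simp; linarith
        rw [gaussianPDFReal, ← Real.exp_add]
        refine (mul_le_of_le_one_left (Real.exp_pos _).le h1).trans (Real.exp_le_exp.2 ?_)
        have := (sq_le_one_iff_abs_le_one h).2 hh
        simp
        nlinarith [sq_nonneg (x - 2 * h)]
      filter_upwards [Metric.closedBall_mem_nhds (0 : ℝ) one_pos] with h hh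
      refine Eventually.of_forall fun x => ENNReal.ofReal_le_ofReal ?_
      have hh' : |h| ≤ 1 := by simpa using hh
      have a1 := hb h hh' x
      have a2 := hb 0 (by simp) x
      have a3 := gaussianPDFReal_nonneg h 1 x
      have a4 := gaussianPDFReal_nonneg 0 1 x
      rw [abs_le]
      constructor <;> linarith
    · have hi : Integrable fun x : ℝ => 2 * (Real.exp 1 * Real.exp (-(1 / 4) * x ^ 2)) :=
        ((integrable_exp_neg_mul_sq (by norm_num)).const_mul _).const_mul _
      exact (hi.lintegral_lt_top).ne
    · refine Eventually.of_forall fun x => ?_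
      have := (((hc x).sub continuous_const).abs.tendsto (x := (0 : ℝ))
        (f := fun h => |gaussianPDFReal h 1 x - gaussianPDFReal 0 1 x|))
      simpa using ENNReal.tendsto_ofReal this
  intro ε hε
  filter_upwards [key.eventually (ge_mem_nhds (pos_iff_ne_zero.2 hε))] with h hh s hs
  rw [gaussianReal_map_add_const, zero_add, gaussianReal_apply _ one_ne_zero,
    gaussianReal_apply _ one_ne_zero]
  calc ∫⁻ x in s, gaussianPDF h 1 x
      ≤ ∫⁻ x in s, (gaussianPDF 0 1 x +
          ENNReal.ofReal |gaussianPDFReal h 1 x - gaussianPDFReal 0 1 x|) := by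
        refine lintegral_mono fun x => ?_
        rw [gaussianPDF, gaussianPDF,
          ← ENNReal.ofReal_add (gaussianPDFReal_nonneg _ _ _) (abs_nonneg _)]
        refine ENNReal.ofReal_le_ofReal ?_
        have := le_abs_self (gaussianPDFReal h 1 x - gaussianPDFReal 0 1 x)
        linarith
    _ = (∫⁻ x in s, gaussianPDF 0 1 x) +
          (∫⁻ x in s, ENNReal.ofReal |gaussianPDFReal h 1 x - gaussianPDFReal 0 1 x|) :=
        lintegral_add_left (measurable_gaussianPDF 0 1) _
    _ ≤ _ := by
        gcongr
        exact (setLIntegral_le_lintegral _ _).trans hh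

lemma translationContinuous_pi_gaussianReal (a : ℕ) :
    TranslationContinuous (Measure.pi fun _ : Fin a => gaussianReal 0 1) := by
  induction a with
  | zero =>
    intro ε hε
    refine Eventually.of_forall fun h s hs => ?_
    have : (fun x : Fin 0 → ℝ => x + h) = id := by ext x i; exact i.elim0
    rw [this, Measure.map_id]
    exact le_self_add
  | succ a ih =>
    have e := (translationContinuous_gaussianReal.prod ih).map
      (Fin.consEquivL ℝ (fun _ : Fin (a + 1) => ℝ))
    have h := (measurePreserving_piFinSuccAbove (fun _ : Fin (a + 1) => gaussianReal 0 1) 0).symm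
    have hf : ⇑(MeasurableEquiv.piFinSuccAbove (fun _ : Fin (a + 1) => ℝ) 0).symm =
        Fin.consEquivL ℝ (fun _ : Fin (a + 1) => ℝ) := by
      ext z i
      refine Fin.cases ?_ (fun j => ?_) i <;> simp [MeasurableEquiv.piFinSuccAbove, Fin.consEquivL]
    rw [← h.map_eq, hf]
    exact e

/-- Positive definiteness makes `√R` invertible, so this law is the image of the standard Gaussian
under a linear equivalence. -/
lemma translationContinuous_multivariateGaussian {a : ℕ} {R : Matrix (Fin a) (Fin a) ℝ}
    (hR : R.PosDef) : TranslationContinuous (multivariateGaussian 0 R) := by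
  open scoped MatrixOrder in
  have hs : TranslationContinuous (stdGaussian (EuclideanSpace ℝ (Fin a))) := by
    rw [← map_pi_eq_stdGaussian]
    exact (translationContinuous_pi_gaussianReal a).map
      (PiLp.continuousLinearEquiv 2 ℝ (fun _ : Fin a => ℝ)).symm
  have hu : IsUnit (CFC.sqrt R) := by
    have h := CFC.sqrt_mul_sqrt_self R hR.posSemidef.nonneg
    have hu : IsUnit (CFC.sqrt R * CFC.sqrt R) := by rw [h]; exact hR.isUnit
    rw [Matrix.isUnit_iff_isUnit_det] at hu ⊢
    rw [Matrix.det_mul] at hu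
    exact isUnit_of_mul_isUnit_left hu
  have hu' : IsUnit (Matrix.toEuclideanCLM (𝕜 := ℝ) (CFC.sqrt R)) := hu.map _
  obtain ⟨f, he⟩ := hu'
  have := hs.map (ContinuousLinearEquiv.ofUnit f)
  have hf : (fun x : Vec a => 0 + Matrix.toEuclideanCLM (𝕜 := ℝ) (CFC.sqrt R) x) =
      ContinuousLinearEquiv.ofUnit f := by
    ext1 x
    rw [zero_add, ← he]
    rfl
  rw [multivariateGaussian, hf]
  exact this

end Translation

/-! ### Shifting one term of an i.i.d. sequence -/

lemma measurable_update_prod {E : Type*} [MeasurableSpace E] (T : ℕ) :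
    Measurable fun z : E × (ℕ → E) => Function.update z.2 T z.1 := by
  refine measurable_pi_lambda _ fun k => ?_
  by_cases hk : k = T
  · subst hk; simpa using measurable_fst
  · simp only [Function.update_of_ne hk]; fun_prop

/-- Replacing one term by an independent copy preserves an i.i.d. law. This isolates the term to be
shifted as a separate factor. -/
lemma infinitePi_map_update {E : Type*} [MeasurableSpace E] (ν : Measure E)
    [IsProbabilityMeasure ν] (T : ℕ) :
    (ν.prod (Measure.infinitePi fun _ : ℕ => ν)).map
      (fun z : E × (ℕ → E) => Function.update z.2 T z.1) = Measure.infinitePi fun _ : ℕ => ν := by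
  have hm := measurable_update_prod (E := E) T
  refine Measure.eq_infinitePi _ fun s t ht => ?_
  rw [Measure.map_apply hm (MeasurableSet.pi s.countable_toSet fun i _ => ht i)]
  have : (fun z : E × (ℕ → E) => Function.update z.2 T z.1) ⁻¹' (s : Set ℕ).pi t =
      (if T ∈ s then t T else Set.univ) ×ˢ ((s.erase T : Finset ℕ) : Set ℕ).pi t := by
    ext z
    simp only [Set.mem_preimage, Set.mem_pi, Set.mem_prod, Finset.mem_coe, Finset.mem_erase]
    constructor
    · intro h
      refine ⟨?_, fun i hi => by simpa [Function.update_of_ne hi.1] using h i hi.2⟩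
      split_ifs with hT
      · simpa using h T hT
      · trivial
    · rintro ⟨h1, h2⟩ i hi
      by_cases hiT : i = T
      · subst hiT; simpa [hi] using h1
      · simpa [Function.update_of_ne hiT] using h2 i ⟨hiT, hi⟩
  rw [this, Measure.prod_prod, Measure.infinitePi_pi _ (fun i _ => ht i)]
  by_cases hT : T ∈ s
  · simp only [hT, if_true]
    exact Finset.mul_prod_erase s (fun i => ν (t i)) hT
  · simp [hT]

/-- The sequence `u` with `h` added to its `T`-th term. -/
def bump {E : Type*} [Add E] (T : ℕ) (h : E) (u : ℕ → E) : ℕ → E :=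
  Function.update u T (u T + h)

lemma measurable_bump {a : ℕ} (T : ℕ) (h : Vec a) : Measurable (bump T h) := by
  refine measurable_pi_lambda _ fun k => ?_
  by_cases hk : k = T
  · subst hk; simp only [bump, Function.update_self]; fun_prop
  · simp only [bump, Function.update_of_ne hk]; fun_prop

lemma TranslationContinuous.infinitePi_bump {a : ℕ} {ν : Measure (Vec a)}
    [IsProbabilityMeasure ν] (hν : TranslationContinuous ν) (T : ℕ) {ε : ℝ≥0∞} (hε : ε ≠ 0) :
    ∀ᶠ h in 𝓝 (0 : Vec a), ExcessLE ((Measure.infinitePi fun _ : ℕ => ν).map (bump T h))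
      (Measure.infinitePi fun _ : ℕ => ν) ε := by
  filter_upwards [hν ε hε] with h hh
  have hm := measurable_update_prod (E := Vec a) T
  have hs : Measurable fun x : Vec a => x + h := by fun_prop
  have key := (hh.prod_const (Measure.infinitePi fun _ : ℕ => ν)).map hm
  rw [infinitePi_map_update] at key
  conv at key => enter [1]; rw [← Measure.map_id (μ := Measure.infinitePi fun _ : ℕ => ν)]
  rw [Measure.map_prod_map _ _ hs measurable_id, Measure.map_map hm (by fun_prop)] at key
  conv => enter [1]; rw [← infinitePi_map_update ν T]
  rw [Measure.map_map (measurable_bump T h) hm]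
  convert key using 3
  ext1 z
  simp [bump]

/-! ### Closed-loop trajectories under attack -/

section Dynamics

variable {n m p r : ℕ}

lemma act_continuous {a b : ℕ} (M : Matrix (Fin a) (Fin b) ℝ) : Continuous (act M) :=
  (Matrix.toEuclideanLin M).continuous_of_finiteDimensional

/-- By linearity the initial state and the noises cancel, so the effect of an injection is
deterministic. -/
lemma traj_sub (S : LTISystem n m p r) (x₀ : Vec n) (X₀ : Vec r) (w : ℕ → Vec n)
    (v i j : ℕ → Vec p) (k : ℕ) :
    S.traj x₀ X₀ w v i k - S.traj x₀ X₀ w v j k =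
      S.traj 0 0 (fun _ => 0) (fun _ => 0) (fun k => i k - j k) k := by
  induction k with
  | zero => simp [LTISystem.traj]; rfl
  | succ k ih =>
    simp only [LTISystem.traj, ← ih, LTISystem.step, Prod.mk_sub_mk, act, map_add, map_sub,
      Prod.fst_sub, Prod.snd_sub]
    ext1 <;> simp <;> abel

lemma step_smul (S : LTISystem n m p r) (c : ℝ) (z : Vec n × Vec r) :
    S.step 0 0 0 (c • z) = c • S.step 0 0 0 z := by
  simp [LTISystem.step, act]

/-- By homogeneity, `e` can be scaled into the ball whose orbits stay in the unit ball; undoing the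
scaling gives the bound. -/
lemma exists_bound_iterate {E : Type*} [NormedAddCommGroup E] [NormedSpace ℝ E] {F : E → E}
    (hF : IsAsymptoticallyStable F) (hs : ∀ (c : ℝ) z, F (c • z) = c • F z) (e : E) :
    ∃ M : ℝ, ∀ t : ℕ, ‖F^[t] e‖ ≤ M := by
  have hi : ∀ (t : ℕ) (c : ℝ) z, F^[t] (c • z) = c • F^[t] z := by
    intro t c
    induction t with
    | zero => simp
    | succ t ih => intro z; rw [Function.iterate_succ_apply, Function.iterate_succ_apply, hs, ih]
  obtain ⟨δ, hδ, h⟩ := hF.1 1 one_pos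
  have hpos : 0 < ‖e‖ + 1 := by positivity
  have hc : 0 < δ / (‖e‖ + 1) := by positivity
  refine ⟨(δ / (‖e‖ + 1))⁻¹, fun t => ?_⟩
  have hlt : ‖(δ / (‖e‖ + 1)) • e‖ < δ := by
    rw [norm_smul, Real.norm_of_nonneg hc.le, div_mul_eq_mul_div, div_lt_iff₀ hpos]
    nlinarith
  have h1 := h _ hlt t
  rw [hi, norm_smul, Real.norm_of_nonneg hc.le] at h1
  rw [← one_div, le_div_iff₀ hc, mul_comm]
  exact h1.le

/-- In the noise-free system started at the origin, the attack moves the plant state along the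
deviation, up to a trajectory of the unattacked closed loop. -/
lemma traj_linearAttack (S : LTISystem n m p r) (T : ℕ) (s₀ : Vec n) (t : ℕ) :
    S.traj 0 0 (fun _ => 0) (fun _ => 0) (injection T (linearAttack S.A S.C s₀)) (T + t) =
      (deviation S.A s₀ t, 0) + (S.step 0 0 0)^[t]
        (S.traj 0 0 (fun _ => 0) (fun _ => 0) (injection T (linearAttack S.A S.C s₀)) T
          - (s₀, 0)) := by
  induction t with
  | zero => simp [deviation]
  | succ t ih =>
    rw [Function.iterate_succ_apply', ← add_assoc, LTISystem.traj, ih]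
    generalize (S.step 0 0 0)^[t] _ = z
    have : injection T (linearAttack S.A S.C s₀) (T + t + 1) =
        -act S.C (act S.A (deviation S.A s₀ t)) := by
      rw [injection, if_pos (by omega), show T + t + 1 - T = t + 1 by omega]
      rfl
    -- The injection cancels the contribution of the deviation to the measurement, so the controller
    -- sees only `z`.
    rw [this]
    simp [LTISystem.step, act, deviation]
    constructor <;> abel

/-- Up to the start of the attack, shifting the measurement noise at that time replaces the
attack. -/
lemma traj_bump_of_le (S : LTISystem n m p r) (T : ℕ) (s₀ x₀ : Vec n) (X₀ : Vec r)
    (w : ℕ → Vec n) (v : ℕ → Vec p) (h : Vec n) (k : ℕ) (hk : k ≤ T) :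
    S.traj x₀ X₀ (bump T h w) (bump T (-act S.C s₀) v) (fun _ => 0) k =
      S.traj x₀ X₀ w v (injection T (linearAttack S.A S.C s₀)) k := by
  induction k with
  | zero => rfl
  | succ k ih =>
    rw [LTISystem.traj, LTISystem.traj, ih (by omega)]
    -- The process noise of index `T` first enters the state at `T + 1`, so `h` plays no role yet.
    have hw : bump T h w k = w k := by simp [bump, Function.update_of_ne (show k ≠ T by omega)]
    rw [hw]
    rcases eq_or_ne (k + 1) T with h' | h'
    · subst h'
      simp [LTISystem.step, bump, injection, linearAttack, deviation, add_assoc]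
    · have : bump T (-act S.C s₀) v (k + 1) = v (k + 1) := by
        simp [bump, Function.update_of_ne h']
      rw [this, injection, if_neg (by omega)]

/-- The shift of the process noise at `T` removes `A s₀ = s₁` from the next state; from then on both
the difference and the deviation evolve by `A`, and the controller states agree. -/
lemma traj_bump_of_gt (S : LTISystem n m p r) (T : ℕ) (s₀ x₀ : Vec n) (X₀ : Vec r)
    (w : ℕ → Vec n) (v : ℕ → Vec p) (j : ℕ) :
    S.traj x₀ X₀ (bump T (-act S.A s₀) w) (bump T (-act S.C s₀) v) (fun _ => 0) (T + 1 + j) =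
      S.traj x₀ X₀ w v (injection T (linearAttack S.A S.C s₀)) (T + 1 + j)
        - (deviation S.A s₀ (j + 1), 0) := by
  have hinj : ∀ j, injection T (linearAttack S.A S.C s₀) (T + 1 + j) =
      -act S.C (act S.A (deviation S.A s₀ j)) := fun j => by
    rw [injection, if_pos (by omega), show T + 1 + j - T = j + 1 by omega]
    rfl
  have hv : ∀ j, bump T (-act S.C s₀) v (T + 1 + j) = v (T + 1 + j) := fun j => by
    simp [bump, Function.update_of_ne (show T + 1 + j ≠ T by omega)]
  induction j with
  | zero =>
    have h1 := hv 0
    have h2 := hinj 0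
    rw [add_zero] at h1 h2 ⊢
    rw [LTISystem.traj, LTISystem.traj, traj_bump_of_le S T s₀ x₀ X₀ w v _ T le_rfl, h1, h2]
    simp only [bump, Function.update_self]
    ext1
    · simp [LTISystem.step, act, deviation]; abel
    · simp [LTISystem.step, act, deviation]; abel
  | succ j ih =>
    have h1 := hv (j + 1)
    have h2 := hinj (j + 1)
    rw [← add_assoc] at h1 h2 ⊢
    rw [LTISystem.traj, LTISystem.traj, ih, h1, h2]
    have hw : bump T (-act S.A s₀) w (T + 1 + j) = w (T + 1 + j) := by
      simp [bump, Function.update_of_ne (show T + 1 + j ≠ T by omega)]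
    rw [hw]
    ext1
    · simp [LTISystem.step, act, deviation]; abel
    · simp [LTISystem.step, act, deviation]; abel

/-- The received measurements as a function of the initial state and of the noises. -/
noncomputable def measurements (S : LTISystem n m p r) (X₀ : Vec r) (inj : ℕ → Vec p) (N : ℕ)
    (z : Vec n × (ℕ → Vec n) × (ℕ → Vec p)) : Fin N → Vec p := fun i =>
  act S.C (S.traj z.1 X₀ z.2.1 z.2.2 inj i).1 + z.2.2 i + inj i

lemma measurable_measurements (S : LTISystem n m p r) (X₀ : Vec r) (inj : ℕ → Vec p) (N : ℕ) :
    Measurable (measurements S X₀ inj N) := by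
  have ht : ∀ k, Continuous fun z : Vec n × (ℕ → Vec n) × (ℕ → Vec p) =>
      S.traj z.1 X₀ z.2.1 z.2.2 inj k := by
    intro k
    induction k with
    | zero => simp only [LTISystem.traj]; fun_prop
    | succ k ih =>
      simp only [LTISystem.traj, LTISystem.step]
      have hA := act_continuous S.A
      have hB := act_continuous S.B
      have hC := act_continuous S.C
      have hAc := act_continuous S.Ac
      have hBc := act_continuous S.Bc
      have hCc := act_continuous S.Cc
      fun_prop
  refine measurable_pi_lambda _ fun i => Continuous.measurable ?_
  have h1 := ht i
  have hC := act_continuous S.C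
  unfold measurements
  fun_prop

/-- The attack is indistinguishable from a shift of the noises at the time it starts. -/
lemma measurements_linearAttack (S : LTISystem n m p r) (X₀ : Vec r) (T N : ℕ) (s₀ : Vec n)
    (z : Vec n × (ℕ → Vec n) × (ℕ → Vec p)) :
    measurements S X₀ (injection T (linearAttack S.A S.C s₀)) N z =
      measurements S X₀ (fun _ => 0) N
        (z.1, bump T (-act S.A s₀) z.2.1, bump T (-act S.C s₀) z.2.2) := by
  ext1 i
  simp only [measurements]
  rcases le_or_gt (i : ℕ) T with hi | hi
  · rw [traj_bump_of_le S T s₀ _ _ _ _ _ _ hi]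
    rcases eq_or_ne (i : ℕ) T with h | h
    · rw [h]
      simp [bump, injection, linearAttack, deviation, add_assoc]
    · simp [bump, Function.update_of_ne h, injection, show ¬ T ≤ (i : ℕ) by omega]
  · obtain ⟨j, hj⟩ := Nat.exists_eq_add_of_le (show T + 1 ≤ (i : ℕ) from hi)
    rw [hj, traj_bump_of_gt]
    have : injection T (linearAttack S.A S.C s₀) (T + 1 + j) =
        -act S.C (deviation S.A s₀ (j + 1)) := by
      rw [injection, if_pos (by omega), show T + 1 + j - T = j + 1 by omega]
      rfl
    rw [this, bump, Function.update_of_ne (show T + 1 + j ≠ T by omega)]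
    simp [act]
    abel

end Dynamics

/-! ### Growth of the deviation -/

section Deviation

variable {n : ℕ}

lemma act_reVec (A : Matrix (Fin n) (Fin n) ℝ) (q : Fin n → ℂ) :
    act A (reVec q) = reVec ((A.map (algebraMap ℝ ℂ)).mulVec q) := by
  ext i
  simp [act, reVec, Matrix.mulVec, dotProduct, Matrix.toLpLin_apply]

lemma deviation_reVec {A : Matrix (Fin n) (Fin n) ℝ} {lam : ℂ} {q : Fin n → ℂ}
    (hq : (A.map (algebraMap ℝ ℂ)).mulVec q = lam • q) (c : ℝ) (t : ℕ) :
    deviation A (c • reVec q) t = c • reVec (lam ^ t • q) := by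
  induction t with
  | zero => simp [deviation]
  | succ t ih =>
    have : act A (c • reVec (lam ^ t • q)) = c • act A (reVec (lam ^ t • q)) := by
      simp [act]
    rw [deviation, ih, this, act_reVec, Matrix.mulVec_smul, hq, smul_smul, pow_succ]

/-- For nonreal `lam`, bounds on the real parts of both `y = lam ^ t * z` and `lam * y` bound the
imaginary part of `y`, contradicting `‖y‖ → ∞`. For real `lam` the real part itself grows
geometrically. -/
lemma exists_lt_abs_re_pow_mul {lam z : ℂ} (hlam : 1 < ‖lam‖) (hz : z.re ≠ 0) (K : ℝ) :
    ∃ t : ℕ, K < |(lam ^ t * z).re| := by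
  by_contra! h
  have hz0 : z ≠ 0 := fun h0 => hz (by simp [h0])
  by_cases him : lam.im = 0
  · obtain ⟨x, rfl⟩ : ∃ x : ℝ, lam = x := ⟨lam.re, by apply Complex.ext <;> simp [him]⟩
    rw [Complex.norm_real, Real.norm_eq_abs] at hlam
    obtain ⟨t, ht⟩ := pow_unbounded_of_one_lt (K / |z.re|) hlam
    rw [div_lt_iff₀ (abs_pos.2 hz)] at ht
    have := h t
    rw [← Complex.ofReal_pow, Complex.re_ofReal_mul, abs_mul, abs_pow] at this
    linarith
  · have hi : 0 < |lam.im| := abs_pos.2 him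
    -- The threshold is the sum of the bounds on `|y.re|` and `|y.im|`, divided by `‖z‖`.
    obtain ⟨t, ht⟩ := pow_unbounded_of_one_lt
      ((K + (|lam.re| * K + K) / |lam.im|) / ‖z‖) hlam
    rw [div_lt_iff₀ (norm_pos_iff.2 hz0), ← norm_pow, ← norm_mul] at ht
    have h1 := h t
    have h2 := h (t + 1)
    rw [pow_succ', mul_assoc, Complex.mul_re] at h2
    have h3 := Complex.norm_le_abs_re_add_abs_im (lam ^ t * z)
    set y := lam ^ t * z
    have h4 : |y.im| ≤ (|lam.re| * K + K) / |lam.im| := by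
      rw [le_div_iff₀ hi, mul_comm, ← abs_mul]
      have h5 := abs_sub (lam.re * y.re) (lam.re * y.re - lam.im * y.im)
      rw [sub_sub_cancel, abs_mul lam.re] at h5
      have := mul_le_mul_of_nonneg_left h1 (abs_nonneg lam.re)
      linarith
    linarith

lemma exists_lt_norm_deviation {A : Matrix (Fin n) (Fin n) ℝ} {lam : ℂ} {q : Fin n → ℂ}
    (hq : IsUnstableEigenpair A lam q) (hre : reVec q ≠ 0) {c : ℝ} (hc : c ≠ 0) (K : ℝ) :
    ∃ t : ℕ, K < ‖deviation A (c • reVec q) t‖ := by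
  have hq' : (A.map (algebraMap ℝ ℂ)).mulVec q = lam • q := hq.2.apply_eq_smul
  obtain ⟨i, hi⟩ : ∃ i, (q i).re ≠ 0 := by
    by_contra! h
    exact hre (by ext i; simpa [reVec] using h i)
  obtain ⟨t, ht⟩ := exists_lt_abs_re_pow_mul hq.1 hi (K / |c|)
  refine ⟨t, ?_⟩
  rw [deviation_reVec hq', norm_smul, Real.norm_eq_abs]
  rw [div_lt_iff₀ (abs_pos.2 hc), mul_comm] at ht
  refine ht.trans_le (mul_le_mul_of_nonneg_left ?_ (abs_nonneg c))
  have := PiLp.norm_apply_le (reVec (lam ^ t • q)) i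
  simpa [reVec] using this

lemma IsUnstable.exists_reVec_ne_zero {A : Matrix (Fin n) (Fin n) ℝ} (hA : IsUnstable A) :
    ∃ (lam : ℂ) (q : Fin n → ℂ), IsUnstableEigenpair A lam q ∧ reVec q ≠ 0 := by
  obtain ⟨lam, q, hq⟩ := hA
  by_cases hre : reVec q = 0
  -- Multiplication by `I` turns the nonzero imaginary part into the real part, up to sign.
  · refine ⟨lam, Complex.I • q, ⟨hq.1, Module.End.hasEigenvector_iff.2
      ⟨Submodule.smul_mem _ _ hq.2.1, smul_ne_zero Complex.I_ne_zero hq.2.2⟩⟩, fun h => hq.2.2 ?_⟩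
    ext i
    have h1 : (q i).re = 0 := by simpa [reVec] using congrArg (fun x : Vec n => x i) hre
    have h2 : (q i).im = 0 := by simpa [reVec] using congrArg (fun x : Vec n => x i) h
    exact Complex.ext h1 h2
  · exact ⟨lam, q, hq, hre⟩

end Deviation

lemma exists_le_norm_plantState_sub {n m p r : ℕ} {Ω : Type*} (S : LTISystem n m p r)
    (T : ℕ) (X₀ : Vec r)
    (hcl : S.ClosedLoopStable) (d : Disturbance Ω n p) {s₀ : Vec n}
    (hs : ∀ K : ℝ, ∃ t : ℕ, K < ‖deviation S.A s₀ t‖) (α : ℝ) :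
    ∃ t : ℕ, ∀ ω, α ≤ ‖plantState S T X₀ d (fun t _ => linearAttack S.A S.C s₀ t) t ω
      - plantState S T X₀ d 0 t ω‖ := by
  obtain ⟨M, hM⟩ := exists_bound_iterate hcl (step_smul S)
    (S.traj 0 0 (fun _ => 0) (fun _ => 0) (injection T (linearAttack S.A S.C s₀)) T - (s₀, 0))
  -- `M` bounds the closed-loop orbit, which can offset at most that much of the deviation.
  obtain ⟨t, ht⟩ := hs (α + M)
  refine ⟨t, fun ω => ?_⟩
  have h0 : (fun k => injection T (linearAttack S.A S.C s₀) k
      - injection T (fun k => (0 : ℕ → Ω → Vec p) k ω) k) =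
      injection T (linearAttack S.A S.C s₀) := by
    ext1 k; simp [injection]
  rw [plantState, plantState, ← Prod.fst_sub, traj_sub, h0, traj_linearAttack, Prod.fst_add]
  have h1 := (norm_fst_le _).trans (hM t)
  have h2 := norm_sub_le_norm_add (deviation S.A s₀ t)
    ((S.step 0 0 0)^[t] (S.traj 0 0 (fun _ => 0) (fun _ => 0)
      (injection T (linearAttack S.A S.C s₀)) T - (s₀, 0))).1
  linarith

/-! ### Stealthiness of small attacks -/

section Stealth

variable {n m p r : ℕ} {Ω : Type*} {mΩ : MeasurableSpace Ω} {μ : Measure Ω}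
  {d : Disturbance Ω n p} {Rw : Matrix (Fin n) (Fin n) ℝ} {Rv : Matrix (Fin p) (Fin p) ℝ}

lemma Disturbance.IsGaussianNoise.measurable_joint (hd : d.IsGaussianNoise μ Rw Rv) :
    Measurable fun ω => (d.init ω, (fun k => d.w k ω), (fun k => d.v k ω)) :=
  hd.measurable_init.prodMk
    ((measurable_pi_lambda _ hd.measurable_w).prodMk (measurable_pi_lambda _ hd.measurable_v))

lemma Disturbance.IsGaussianNoise.map_joint [IsProbabilityMeasure μ]
    (hd : d.IsGaussianNoise μ Rw Rv) :
    μ.map (fun ω => (d.init ω, (fun k => d.w k ω), (fun k => d.v k ω))) =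
      (μ.map d.init).prod ((Measure.infinitePi fun _ : ℕ => multivariateGaussian 0 Rw).prod
        (Measure.infinitePi fun _ : ℕ => multivariateGaussian 0 Rv)) := by
  have mw : Measurable fun ω k => d.w k ω := measurable_pi_lambda _ hd.measurable_w
  have mv : Measurable fun ω k => d.v k ω := measurable_pi_lambda _ hd.measurable_v
  rw [hd.indepFun_init.map_prod_eq_prod_map_map hd.measurable_init.aemeasurable
      (mw.prodMk mv).aemeasurable,
    hd.indepFun_w_v.map_prod_eq_prod_map_map mw.aemeasurable mv.aemeasurable,
    (hd.iIndepFun_w.hasLaw_infinitePi hd.law_w mw.aemeasurable).map_eq,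
    (hd.iIndepFun_v.hasLaw_infinitePi hd.law_v mv.aemeasurable).map_eq]

lemma isStealthy_of_excessLE [IsProbabilityMeasure μ] (S : LTISystem n m p r) (T : ℕ) (X₀ : Vec r)
    (hd : d.IsGaussianNoise μ Rw Rv) (s₀ : Vec n) {ε δ : ℝ} (hε : 0 ≤ ε) (hδ : 0 ≤ δ)
    (hw : ExcessLE ((Measure.infinitePi fun _ : ℕ => multivariateGaussian 0 Rw).map
      (bump T (-act S.A s₀))) (Measure.infinitePi fun _ : ℕ => multivariateGaussian 0 Rw)
      (ENNReal.ofReal ε))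
    (hv : ExcessLE ((Measure.infinitePi fun _ : ℕ => multivariateGaussian 0 Rv).map
      (bump T (-act S.C s₀))) (Measure.infinitePi fun _ : ℕ => multivariateGaussian 0 Rv)
      (ENNReal.ofReal δ)) :
    IsStealthy S T X₀ d μ (ε + δ) fun t _ => linearAttack S.A S.C s₀ t := by
  rintro ⟨t, D, hD, hlt⟩
  set J := fun ω => (d.init ω, (fun k => d.w k ω), (fun k => d.v k ω)) with hJ
  have mJ : Measurable J := hd.measurable_joint
  set sh : Vec n × (ℕ → Vec n) × (ℕ → Vec p) → Vec n × (ℕ → Vec n) × (ℕ → Vec p) :=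
    Prod.map id (Prod.map (bump T (-act S.A s₀)) (bump T (-act S.C s₀))) with hsh
  have mbw := measurable_bump T (-act S.A s₀)
  have mbv := measurable_bump T (-act S.C s₀)
  have msh : Measurable sh := measurable_id.prodMap (mbw.prodMap mbv)
  set B : Set (Vec n × (ℕ → Vec n) × (ℕ → Vec p)) :=
    measurements S X₀ (fun _ => 0) (T + t + 1) ⁻¹' (D ⁻¹' {true}) with hB
  have mB : MeasurableSet B :=
    measurable_measurements S X₀ _ _ (hD (measurableSet_singleton true))
  -- The same set `B` of disturbances describes both alarms; the attack only moves the noises before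
  -- `B` is tested.
  have e1 : {ω | D (received S T X₀ d (fun t _ => linearAttack S.A S.C s₀ t) t ω) = true} =
      J ⁻¹' (sh ⁻¹' B) := by
    ext ω
    change D (measurements S X₀ (injection T (linearAttack S.A S.C s₀)) (T + t + 1) (J ω)) = true
      ↔ _
    rw [measurements_linearAttack]
    rfl
  have e2 : {ω | D (received S T X₀ d 0 t ω) = true} = J ⁻¹' B := by
    have h0 : injection T (fun _ => (0 : Vec p)) = fun _ => 0 := by
      ext1 k; simp [injection]
    ext ω
    change D (measurements S X₀ (injection T fun _ => 0) (T + t + 1) (J ω)) = true ↔ _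
    rw [h0]
    rfl
  have := Measure.isProbabilityMeasure_map (μ := μ) hd.measurable_init.aemeasurable
  have := Measure.isProbabilityMeasure_map
    (μ := Measure.infinitePi fun _ : ℕ => multivariateGaussian 0 Rw) mbw.aemeasurable
  have := Measure.isProbabilityMeasure_map
    (μ := Measure.infinitePi fun _ : ℕ => multivariateGaussian 0 Rv) mbv.aemeasurable
  -- By independence the joint law is a product, and only its two noise factors are shifted.
  have key := (hw.prod hv).const_prod (μ.map d.init)
  rw [Measure.map_prod_map _ _ mbw mbv] at key
  conv at key => enter [1, 1]; rw [← Measure.map_id (μ := μ.map d.init)]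
  rw [Measure.map_prod_map _ _ measurable_id (mbw.prodMap mbv), ← hd.map_joint] at key
  have h := key B mB
  rw [Measure.map_map msh mJ, Measure.map_apply (msh.comp mJ) mB, Measure.map_apply mJ mB,
    ← ENNReal.ofReal_add hδ hε] at h
  have h' := ENNReal.toReal_mono (by finiteness) h
  rw [ENNReal.toReal_add (by finiteness) (by finiteness),
    ENNReal.toReal_ofReal (by positivity)] at h'
  rw [alarmProb, alarmProb, e1, e2, measureReal_def, measureReal_def] at hlt
  rw [Set.preimage_comp] at h'
  linarith

lemma eventually_isStealthy [IsProbabilityMeasure μ] (S : LTISystem n m p r) (T : ℕ)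
    (X₀ : Vec r) (hRw : Rw.PosDef)
    (hRv : Rv.PosDef) (hd : d.IsGaussianNoise μ Rw Rv) {ε : ℝ} (hε : 0 < ε) :
    ∀ᶠ s₀ in 𝓝 (0 : Vec n),
      IsStealthy S T X₀ d μ ε fun t _ => linearAttack S.A S.C s₀ t := by
  have hε' : ENNReal.ofReal (ε / 2) ≠ 0 := by simpa using hε
  have hA : Tendsto (fun s : Vec n => -act S.A s) (𝓝 0) (𝓝 0) := by
    have h := (act_continuous S.A).neg.tendsto 0
    rwa [Pi.neg_apply, act, map_zero, neg_zero] at h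
  have hC : Tendsto (fun s : Vec n => -act S.C s) (𝓝 0) (𝓝 0) := by
    have h := (act_continuous S.C).neg.tendsto 0
    rwa [Pi.neg_apply, act, map_zero, neg_zero] at h
  filter_upwards [
    hA.eventually ((translationContinuous_multivariateGaussian hRw).infinitePi_bump T hε'),
    hC.eventually ((translationContinuous_multivariateGaussian hRv).infinitePi_bump T hε')]
    with s₀ hw hv
  simpa using isStealthy_of_excessLE S T X₀ hd s₀ (half_pos hε).le (half_pos hε).le hw hv

end Stealth

end SensorAttack

theorem corollary1 {n m p r : ℕ} (S : LTISystem n m p r) (T : ℕ) (X₀ : Vec r)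
    (Rw : Matrix (Fin n) (Fin n) ℝ) (Rv : Matrix (Fin p) (Fin p) ℝ)
    (hRw : Rw.PosDef) (hRv : Rv.PosDef)
    {Ω : Type*} [MeasurableSpace Ω] (μ : Measure Ω) [IsProbabilityMeasure μ]
    (d : Disturbance Ω n p) (hd : d.IsGaussianNoise μ Rw Rv)
    (hA : IsUnstable S.A) (hcl : S.ClosedLoopStable) :
    (∀ ε : ℝ, 0 < ε → ∀ α : ℝ, IsAttackable S T X₀ d μ ε α) ∧
    ∀ (lam : ℂ) (q : Fin n → ℂ), IsUnstableEigenpair S.A lam q → reVec q ≠ 0 →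
      ∀ ε : ℝ, 0 < ε → ∃ c₀ : ℝ, 0 < c₀ ∧ ∀ c : ℝ, 0 < |c| → |c| ≤ c₀ →
        ∀ α : ℝ, IsSuccessful S T X₀ d μ ε α
          (fun t _ => linearAttack S.A S.C (c • reVec q) t) := by
  have main : ∀ (lam : ℂ) (q : Fin n → ℂ), IsUnstableEigenpair S.A lam q → reVec q ≠ 0 →
      ∀ ε : ℝ, 0 < ε → ∃ c₀ : ℝ, 0 < c₀ ∧ ∀ c : ℝ, 0 < |c| → |c| ≤ c₀ →
        ∀ α : ℝ, IsSuccessful S T X₀ d μ ε α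
          (fun t _ => linearAttack S.A S.C (c • reVec q) t) := by
    intro lam q hq hre ε hε
    have h0 : Tendsto (fun c : ℝ => c • reVec q) (𝓝 0) (𝓝 0) := by
      simpa using (continuous_id.smul continuous_const).tendsto (x := (0 : ℝ))
        (f := fun c : ℝ => c • reVec q)
    obtain ⟨c₀, hc₀, h⟩ := Metric.nhds_basis_closedBall.eventually_iff.1
      (h0.eventually (eventually_isStealthy S T X₀ hRw hRv hd hε))
    -- Stealthiness alone determines `c₀`. Any nonzero `c` gives unbounded growth, so `α` affects
    -- only the time `t`.
    refine ⟨c₀, hc₀, fun c hc hcc α => ⟨?_, h (by simpa using hcc)⟩⟩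
    obtain ⟨t, ht⟩ := exists_le_norm_plantState_sub S T X₀ hcl d
      (exists_lt_norm_deviation hq hre (abs_pos.1 hc)) α
    exact ⟨t, Eventually.of_forall ht⟩
  refine ⟨fun ε hε α => ?_, main⟩
  obtain ⟨lam, q, hq, hre⟩ := hA.exists_reVec_ne_zero
  obtain ⟨c₀, hc₀, h⟩ := main lam q hq hre ε hε
  refine ⟨fun t _ => linearAttack S.A S.C (c₀ • reVec q) t, fun t => ?_,
    h c₀ (abs_pos.2 hc₀.ne') (abs_of_pos hc₀).le α⟩
  exact ⟨fun _ => linearAttack S.A S.C (c₀ • reVec q) t, measurable_const, fun _ => rfl⟩
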